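/- Let $\mathcal{H}$ be a real Hilbert space and let $A,B\subseteq\mathcal{H}$ be nonempty, closed and convex. For a nonempty closed convex set $C\subseteq\mathcal{H}$, let $P_C(x)$ denote the unique point of $C$ nearest to $x$, let $C-q=\{c-q : c\in C\}$, and let $N_C(x)=\{u\in\mathcal{H} : \langle u,c-x\rangle\le 0\ \text{for all } c\in C\}$ if $x\in C$ and $N_C(x)=\emptyset$ otherwise; write $(N_A+N_B)(x)=\{u+v : u\in N_A(x),\ v\in N_B(x)\}$. Let $(\lambda_n)_{n\ge 0}$ be a sequence in $[0,1]$ with $\sum_{n\ge 0}\lambda_n(1-\lambda_n)=+\infty$ and let $\beta\in\,]0,1[$. Given $q\in\mathcal{H}$ and any $x_0\in\mathcal{H}$, set $$T=(2\beta P_{B-q}-\operatorname{Id})(2\beta P_{A-q}-\operatorname{Id}),\qquad x_{n+1}=(1-\lambda_n)x_n+\lambda_n T(x_n),\quad n=0,1,2,\ldots$$ Suppose that $A\cap B\neq\emptyset$ and $q-P_{A\cap B}(q)\in(N_A+N_B)(P_{A\cap B}(q))$. Then: 1. $(x_{n+1}-x_n)_{n\ge 0}$ converges strongly to $0$; 2.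 $(x_n)_{n\ge 0}$ converges weakly to a point $x^\star$ with $T(x^\star)=x^\star$ and $P_A(q+x^\star)=P_{A\cap B}(q)$; 3. $(P_A(q+x_n))_{n\ge 0}$ converges strongly to $P_{A\cap B}(q)$. -/

import Mathlib

open Filter Topology
open scoped Pointwise

namespace AAMR

variable {H : Type*} [NormedAddCommGroup H] [InnerProductSpace ℝ H]

/-- `p` is a nearest point of `C` to `x`, i.e. `p` belongs to `argmin_{c ∈ C} ‖x - c‖`. -/
def IsNearestPoint (C : Set H) (x p : H) : Prop :=
  p ∈ C ∧ ∀ c ∈ C, ‖x - p‖ ≤ ‖x - c‖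

/-- The projector `P_C`. It picks a nearest point of `C` to `x`; for a nonempty closed convex
set `C` of a Hilbert space that point exists and is unique (`proj_eq_iff`). -/
noncomputable def proj (C : Set H) (x : H) : H :=
  Classical.epsilon (IsNearestPoint C x)

/-- The normal cone operator `N_C`. -/
def normalCone (C : Set H) (x : H) : Set H :=
  {u | x ∈ C ∧ ∀ c ∈ C, inner ℝ u (c - x) ≤ 0}

/-- The translated set `C - q`. -/
def translate (C : Set H) (q : H) : Set H :=
  (fun c => c - q) '' C

/-- The modified reflector `2 β P_C - Id`. -/
noncomputable def modifiedReflector (β : ℝ) (C : Set H) (x : H) : H :=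
  (2 * β) • proj C x - x

/-- The composition `(2 β P_{B-q} - Id) (2 β P_{A-q} - Id)`. -/
noncomputable def aamrOperator (β : ℝ) (A B : Set H) (q x : H) : H :=
  modifiedReflector β (translate B q) (modifiedReflector β (translate A q) x)

theorem exists_isNearestPoint [CompleteSpace H] {C : Set H} (hne : C.Nonempty)
    (hcl : IsClosed C) (hconv : Convex ℝ C) (x : H) : ∃ p, IsNearestPoint C x p := by
  obtain ⟨p, hp, h⟩ := exists_norm_eq_iInf_of_complete_convex hne hcl.isComplete hconv x
  refine ⟨p, hp, fun c hc => ?_⟩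
  rw [h]
  exact ciInf_le ⟨0, by rintro _ ⟨c, rfl⟩; exact norm_nonneg _⟩ (⟨c, hc⟩ : C)

theorem isNearestPoint_proj [CompleteSpace H] {C : Set H} (hne : C.Nonempty)
    (hcl : IsClosed C) (hconv : Convex ℝ C) (x : H) : IsNearestPoint C x (proj C x) :=
  Classical.epsilon_spec (exists_isNearestPoint hne hcl hconv x)

theorem IsNearestPoint.inner_le {C : Set H} (hconv : Convex ℝ C) {x p : H}
    (h : IsNearestPoint C x p) : ∀ c ∈ C, inner ℝ (x - p) (c - p) ≤ 0 := by
  refine (norm_eq_iInf_iff_real_inner_le_zero hconv h.1).1 (le_antisymm ?_ ?_)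
  · have : Nonempty C := ⟨⟨p, h.1⟩⟩
    exact le_ciInf fun c => h.2 c c.2
  · exact ciInf_le ⟨0, by rintro _ ⟨c, rfl⟩; exact norm_nonneg _⟩ (⟨p, h.1⟩ : C)

theorem IsNearestPoint.unique {C : Set H} (hconv : Convex ℝ C) {x p p' : H}
    (h : IsNearestPoint C x p) (h' : IsNearestPoint C x p') : p = p' := by
  have h1 := h.inner_le hconv p' h'.1
  have h2 := h'.inner_le hconv p h.1
  have h3 : inner ℝ (p - p') (p - p') ≤ 0 := by
    have : inner ℝ (p - p') (p - p') = inner ℝ (x - p) (p' - p) + inner ℝ (x - p') (p - p') := by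
      rw [← neg_sub p p', inner_neg_right, ← sub_eq_neg_add, ← inner_sub_left]
      congr 1
      abel
    linarith
  exact sub_eq_zero.1 (inner_self_eq_zero (𝕜 := ℝ) |>.1 (le_antisymm h3 real_inner_self_nonneg))

theorem proj_eq_iff [CompleteSpace H] {C : Set H} (hne : C.Nonempty)
    (hcl : IsClosed C) (hconv : Convex ℝ C) (x p : H) :
    proj C x = p ↔ IsNearestPoint C x p :=
  ⟨fun h => h ▸ isNearestPoint_proj hne hcl hconv x,
    fun h => (isNearestPoint_proj hne hcl hconv x).unique hconv h⟩

end AAMR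

/-! Write `p` for the projection of `q` onto `A ∩ B`, and split `q - p = u + v` with `u`, `v` normal
to `A`, `B` at `p`. The operator is nonexpansive, and the splitting gives it the explicit fixed
point `p - q + 2(1 - β)u` (`isFixedPt_aamrOperator`), so Krasnoselskii–Mann theory yields asymptotic
regularity and a weak limit (`mann_residual_tendsto_zero`, `mann_tendsto_weak`).

Strong convergence of the shadows uses `β < 1`: `norm_sq_aamrOperator_sub_le` improves
nonexpansiveness by a positive multiple of the squared distance between shadows. Against a fixed
point, the vanishing residual forces that distance to zero. All fixed points thus share one shadow,
and the explicit one shows that it is `p`. -/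

namespace AAMR

/-! ### Krasnoselskii–Mann iterations of nonexpansive maps -/

section KrasnoselskiiMann

variable {H : Type*} [NormedAddCommGroup H] [InnerProductSpace ℝ H]

/-- A bounded family in a Hilbert space converges weakly along every ultrafilter. -/
theorem exists_tendsto_inner_ultrafilter [CompleteSpace H] {ι : Type*} (U : Ultrafilter ι)
    {u : ι → H} {R : ℝ} (hR : ∀ i, ‖u i‖ ≤ R) :
    ∃ z : H, ∀ y, Tendsto (fun i => inner ℝ (u i) y) U (𝓝 (inner ℝ z y)) := by
  -- The Riesz isometry moves the family to the dual, where Banach–Alaoglu applies.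
  let f : ι → WeakDual ℝ H := fun i => StrongDual.toWeakDual (InnerProductSpace.toDual ℝ H (u i))
  have hmem : ∀ i, f i ∈ WeakDual.toStrongDual ⁻¹' Metric.closedBall (0 : StrongDual ℝ H) R := by
    intro i
    simpa [f] using hR i
  obtain ⟨φ, -, hφ⟩ := (WeakDual.isCompact_closedBall (𝕜 := ℝ) (0 : StrongDual ℝ H) R)
    |>.ultrafilter_le_nhds (U.map f)
    (le_principal_iff.2 (Filter.mem_map.2 (Filter.Eventually.of_forall hmem)))
  refine ⟨(InnerProductSpace.toDual ℝ H).symm (WeakDual.toStrongDual φ), fun y => ?_⟩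
  rw [InnerProductSpace.toDual_symm_apply]
  exact ((WeakDual.eval_continuous y).tendsto φ).comp (show Tendsto f U (𝓝 φ) from hφ)

theorem tendsto_toWeakSpace_of_tendsto_inner [CompleteSpace H] {ι : Type*} {l : Filter ι}
    {u : ι → H} {z : H} (h : ∀ y, Tendsto (fun i => inner ℝ (u i) y) l (𝓝 (inner ℝ z y))) :
    Tendsto (fun i => toWeakSpace ℝ H (u i)) l (𝓝 (toWeakSpace ℝ H z)) := by
  have hinj : Function.Injective (topDualPairing ℝ H).flip := by
    intro a b hab
    refine ext_inner_left ℝ fun v => ?_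
    exact LinearMap.congr_fun hab (innerSL ℝ v)
  refine (WeakBilin.tendsto_iff_forall_eval_tendsto (topDualPairing ℝ H).flip hinj).2 fun φ => ?_
  have := h ((InnerProductSpace.toDual ℝ H).symm φ)
  have e : ∀ y, inner ℝ y ((InnerProductSpace.toDual ℝ H).symm φ) = φ y := fun y => by
    rw [real_inner_comm, InnerProductSpace.toDual_symm_apply]
  rw [e, funext fun i => e (u i)] at this
  exact this

/-- Demiclosedness of `Id - T` at `0`, for a nonexpansive map `T`. -/
theorem isFixedPt_of_tendsto_inner {ι : Type*} {l : Filter ι} [l.NeBot] {T : H → H}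
    (hT : ∀ x y, ‖T x - T y‖ ≤ ‖x - y‖) {u : ι → H} {R : ℝ} (hR : ∀ i, ‖u i‖ ≤ R)
    (hreg : Tendsto (fun i => ‖u i - T (u i)‖) l (𝓝 0)) {z : H}
    (hz : ∀ y, Tendsto (fun i => inner ℝ (u i) y) l (𝓝 (inner ℝ z y))) :
    Function.IsFixedPt T z := by
  -- Expand the square of `u i - T z = (u i - z) + (z - T z)`; nonexpansiveness bounds the left side
  -- by `(‖u i - T (u i)‖ + ‖u i - z‖) ^ 2`, and `‖u i - z‖ ^ 2` cancels.
  have key : ∀ i, ‖z - T z‖ ^ 2 ≤ ‖u i - T (u i)‖ ^ 2 + 2 * (R + ‖z‖) * ‖u i - T (u i)‖ -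
      2 * (inner ℝ (u i) (z - T z) - inner ℝ z (z - T z)) := by
    intro i
    have h1 := norm_add_sq_real (u i - z) (z - T z)
    rw [sub_add_sub_cancel, inner_sub_left] at h1
    have h2 : ‖u i - T z‖ ≤ ‖u i - T (u i)‖ + ‖u i - z‖ :=
      (norm_sub_le_norm_sub_add_norm_sub _ (T (u i)) _).trans
        (add_le_add_right (hT _ _) _)
    have h3 : ‖u i - z‖ ≤ R + ‖z‖ := (norm_sub_le _ _).trans (add_le_add_left (hR i) _)
    have h4 := pow_le_pow_left₀ (norm_nonneg _) h2 2
    have h5 := mul_le_mul_of_nonneg_left h3 (norm_nonneg (u i - T (u i)))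
    nlinarith
  have hlim : Tendsto (fun i => ‖u i - T (u i)‖ ^ 2 + 2 * (R + ‖z‖) * ‖u i - T (u i)‖ -
      2 * (inner ℝ (u i) (z - T z) - inner ℝ z (z - T z))) l (𝓝 0) := by
    have := ((hreg.pow 2).add (hreg.const_mul (2 * (R + ‖z‖)))).sub
      (((hz (z - T z)).sub_const (inner ℝ z (z - T z))).const_mul 2)
    simpa using this
  have h0 : ‖z - T z‖ ^ 2 ≤ 0 := ge_of_tendsto' hlim key
  have h1 : z - T z = 0 := norm_eq_zero.1 (pow_eq_zero_iff two_ne_zero |>.1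
    (le_antisymm h0 (sq_nonneg _)))
  exact (sub_eq_zero.1 h1).symm

/-- Opial's lemma: weak cluster points at which the distance of the sequence converges agree. -/
theorem eq_of_tendsto_inner_ultrafilter {u : ℕ → H} {U V : Ultrafilter ℕ}
    (hU : (U : Filter ℕ) ≤ atTop) (hV : (V : Filter ℕ) ≤ atTop) {z w : H} {a b : ℝ}
    (hz : Tendsto (fun n => inner ℝ (u n) (z - w)) U (𝓝 (inner ℝ z (z - w))))
    (hw : Tendsto (fun n => inner ℝ (u n) (z - w)) V (𝓝 (inner ℝ w (z - w))))
    (ha : Tendsto (fun n => ‖u n - z‖ ^ 2) atTop (𝓝 a))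
    (hb : Tendsto (fun n => ‖u n - w‖ ^ 2) atTop (𝓝 b)) : z = w := by
  -- The difference of the two squared distances is affine in `u n`, so this inner product converges
  -- along the whole sequence.
  have hlim : Tendsto (fun n => inner ℝ (u n) (z - w)) atTop
      (𝓝 ((b - a + (‖z‖ ^ 2 - ‖w‖ ^ 2)) / 2)) := by
    refine (((hb.sub ha).add_const (‖z‖ ^ 2 - ‖w‖ ^ 2)).div_const 2).congr fun n => ?_
    rw [norm_sub_sq_real, norm_sub_sq_real, inner_sub_right]
    ring
  have h : inner ℝ z (z - w) = inner ℝ w (z - w) :=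
    (tendsto_nhds_unique hz (hlim.mono_left hU)).trans
      (tendsto_nhds_unique hw (hlim.mono_left hV)).symm
  rw [← sub_eq_zero, ← inner_sub_left] at h
  exact sub_eq_zero.1 (inner_self_eq_zero (𝕜 := ℝ) |>.1 h)

theorem norm_sq_convex_combination (a b : H) (t : ℝ) :
    ‖(1 - t) • a + t • b‖ ^ 2 =
      (1 - t) * ‖a‖ ^ 2 + t * ‖b‖ ^ 2 - t * (1 - t) * ‖a - b‖ ^ 2 := by
  rw [norm_add_sq_real, norm_sub_sq_real, norm_smul, norm_smul, real_inner_smul_left,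
    real_inner_smul_right, mul_pow, mul_pow, Real.norm_eq_abs, Real.norm_eq_abs, sq_abs, sq_abs]
  ring

/-! ### Fejér monotonicity and asymptotic regularity -/

variable {T : H → H} {lam : ℕ → ℝ} {x : ℕ → H}

theorem mann_norm_sq_le (hT : ∀ x y, ‖T x - T y‖ ≤ ‖x - y‖)
    (hlam : ∀ n, lam n ∈ Set.Icc (0 : ℝ) 1)
    (hx : ∀ n, x (n + 1) = (1 - lam n) • x n + lam n • T (x n))
    {z : H} (hz : Function.IsFixedPt T z) (n : ℕ) :
    ‖x (n + 1) - z‖ ^ 2 ≤ ‖x n - z‖ ^ 2 - lam n * (1 - lam n) * ‖x n - T (x n)‖ ^ 2 := by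
  have h1 : x (n + 1) - z = (1 - lam n) • (x n - z) + lam n • (T (x n) - z) := by
    rw [hx n]
    module
  have h2 : ‖T (x n) - z‖ ≤ ‖x n - z‖ := by
    simpa only [hz.eq] using hT (x n) z
  have h3 := mul_le_mul_of_nonneg_left (pow_le_pow_left₀ (norm_nonneg _) h2 2) (hlam n).1
  rw [h1, norm_sq_convex_combination, sub_sub_sub_cancel_right]
  linarith

theorem mann_norm_sq_antitone (hT : ∀ x y, ‖T x - T y‖ ≤ ‖x - y‖)
    (hlam : ∀ n, lam n ∈ Set.Icc (0 : ℝ) 1)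
    (hx : ∀ n, x (n + 1) = (1 - lam n) • x n + lam n • T (x n))
    {z : H} (hz : Function.IsFixedPt T z) : Antitone fun n => ‖x n - z‖ ^ 2 :=
  antitone_nat_of_succ_le fun n => (mann_norm_sq_le hT hlam hx hz n).trans
    (sub_le_self _ (mul_nonneg (mul_nonneg (hlam n).1 (sub_nonneg.2 (hlam n).2)) (sq_nonneg _)))

theorem mann_norm_le (hT : ∀ x y, ‖T x - T y‖ ≤ ‖x - y‖)
    (hlam : ∀ n, lam n ∈ Set.Icc (0 : ℝ) 1)
    (hx : ∀ n, x (n + 1) = (1 - lam n) • x n + lam n • T (x n))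
    {z : H} (hz : Function.IsFixedPt T z) (n : ℕ) : ‖x n - z‖ ≤ ‖x 0 - z‖ :=
  (sq_le_sq₀ (norm_nonneg _) (norm_nonneg _)).1 (mann_norm_sq_antitone hT hlam hx hz n.zero_le)

/-- A step of length `lam n` times the residual leaves `1 - lam n` times it to `T (x n)`, while `T`
moves by at most the step; the two add up to the old residual. -/
theorem mann_residual_antitone (hT : ∀ x y, ‖T x - T y‖ ≤ ‖x - y‖)
    (hlam : ∀ n, lam n ∈ Set.Icc (0 : ℝ) 1)
    (hx : ∀ n, x (n + 1) = (1 - lam n) • x n + lam n • T (x n)) :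
    Antitone fun n => ‖x n - T (x n)‖ := by
  refine antitone_nat_of_succ_le fun n => ?_
  have h0 := (hlam n).1
  have h1 := sub_nonneg.2 (hlam n).2
  have h2 : x (n + 1) - T (x n) = (1 - lam n) • (x n - T (x n)) := by
    rw [hx n]
    module
  have h3 : x n - x (n + 1) = lam n • (x n - T (x n)) := by
    rw [hx n]
    module
  calc ‖x (n + 1) - T (x (n + 1))‖
      ≤ ‖x (n + 1) - T (x n)‖ + ‖T (x n) - T (x (n + 1))‖ :=
        norm_sub_le_norm_sub_add_norm_sub _ _ _
    _ ≤ ‖x (n + 1) - T (x n)‖ + ‖x n - x (n + 1)‖ := add_le_add_right (hT _ _) _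
    _ = ‖x n - T (x n)‖ := by
        rw [h2, h3, norm_smul, norm_smul, Real.norm_of_nonneg h0, Real.norm_of_nonneg h1]
        ring

/-- The decreases of the squared distance to `z` telescope. Since residuals decrease, the last one
factors out of the sum, which gives an explicit bound by the inverse of the divergent series. -/
theorem mann_residual_tendsto_zero (hT : ∀ x y, ‖T x - T y‖ ≤ ‖x - y‖)
    (hlam : ∀ n, lam n ∈ Set.Icc (0 : ℝ) 1)
    (hlamsum : Tendsto (fun N => ∑ n ∈ Finset.range N, lam n * (1 - lam n)) atTop atTop)
    (hx : ∀ n, x (n + 1) = (1 - lam n) • x n + lam n • T (x n))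
    {z : H} (hz : Function.IsFixedPt T z) :
    Tendsto (fun n => ‖x n - T (x n)‖) atTop (𝓝 0) := by
  have hanti := mann_residual_antitone hT hlam hx
  have hsum : ∀ N, (∑ n ∈ Finset.range N, lam n * (1 - lam n)) * ‖x N - T (x N)‖ ^ 2 ≤
      ‖x 0 - z‖ ^ 2 := by
    intro N
    have h : ∑ n ∈ Finset.range N, lam n * (1 - lam n) * ‖x N - T (x N)‖ ^ 2 ≤
        ∑ n ∈ Finset.range N, (‖x n - z‖ ^ 2 - ‖x (n + 1) - z‖ ^ 2) := by
      refine Finset.sum_le_sum fun n hn => ?_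
      have h1 := mann_norm_sq_le hT hlam hx hz n
      have h2 : ‖x N - T (x N)‖ ^ 2 ≤ ‖x n - T (x n)‖ ^ 2 :=
        pow_le_pow_left₀ (norm_nonneg _) (hanti (Finset.mem_range.1 hn).le) 2
      have h3 := mul_le_mul_of_nonneg_left h2
        (mul_nonneg (hlam n).1 (sub_nonneg.2 (hlam n).2))
      linarith
    rw [Finset.sum_range_sub', ← Finset.sum_mul] at h
    linarith [sq_nonneg ‖x N - z‖]
  have hsq : Tendsto (fun n => ‖x n - T (x n)‖ ^ 2) atTop (𝓝 0) := by
    refine squeeze_zero' (Eventually.of_forall fun n => sq_nonneg _) ?_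
      (hlamsum.const_div_atTop (‖x 0 - z‖ ^ 2))
    filter_upwards [hlamsum.eventually_gt_atTop 0] with N hN
    rw [le_div_iff₀ hN, mul_comm]
    exact hsum N
  simpa using hsq.sqrt

theorem mann_sub_succ_tendsto_zero (hlam : ∀ n, lam n ∈ Set.Icc (0 : ℝ) 1)
    (hx : ∀ n, x (n + 1) = (1 - lam n) • x n + lam n • T (x n))
    (hreg : Tendsto (fun n => ‖x n - T (x n)‖) atTop (𝓝 0)) :
    Tendsto (fun n => x (n + 1) - x n) atTop (𝓝 0) := by
  refine squeeze_zero_norm (fun n => ?_) hreg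
  have h : x (n + 1) - x n = (-lam n) • (x n - T (x n)) := by
    rw [hx n]
    module
  rw [h, norm_smul, norm_neg, Real.norm_of_nonneg (hlam n).1]
  exact mul_le_of_le_one_left (norm_nonneg _) (hlam n).2

/-- Krasnoselskii–Mann iterations converge weakly to a fixed point. -/
theorem mann_tendsto_weak [CompleteSpace H] (hT : ∀ x y, ‖T x - T y‖ ≤ ‖x - y‖)
    (hlam : ∀ n, lam n ∈ Set.Icc (0 : ℝ) 1)
    (hx : ∀ n, x (n + 1) = (1 - lam n) • x n + lam n • T (x n))
    (hreg : Tendsto (fun n => ‖x n - T (x n)‖) atTop (𝓝 0))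
    {z₀ : H} (hz₀ : Function.IsFixedPt T z₀) :
    ∃ z, Function.IsFixedPt T z ∧
      Tendsto (fun n => toWeakSpace ℝ H (x n)) atTop (𝓝 (toWeakSpace ℝ H z)) := by
  have hbdd : ∀ n, ‖x n‖ ≤ ‖x 0 - z₀‖ + ‖z₀‖ := fun n =>
    (norm_le_norm_sub_add _ _).trans (add_le_add_left (mann_norm_le hT hlam hx hz₀ n) _)
  have hconv : ∀ z, Function.IsFixedPt T z →
      ∃ a, Tendsto (fun n => ‖x n - z‖ ^ 2) atTop (𝓝 a) := fun z hz =>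
    ⟨_, tendsto_atTop_ciInf (mann_norm_sq_antitone hT hlam hx hz)
      ⟨0, by rintro _ ⟨n, rfl⟩; exact sq_nonneg _⟩⟩
  have hcluster : ∀ U : Ultrafilter ℕ, (U : Filter ℕ) ≤ atTop → ∃ z, Function.IsFixedPt T z ∧
      ∀ y, Tendsto (fun n => inner ℝ (x n) y) U (𝓝 (inner ℝ z y)) := by
    intro U hU
    obtain ⟨z, hz⟩ := exists_tendsto_inner_ultrafilter U hbdd
    exact ⟨z, isFixedPt_of_tendsto_inner hT hbdd (hreg.mono_left hU) hz, hz⟩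
  -- An arbitrary ultrafilter supplies the candidate limit; Opial's lemma identifies every other
  -- cluster point with it.
  obtain ⟨z, hzfix, hz⟩ := hcluster (Ultrafilter.of atTop) (Ultrafilter.of_le _)
  refine ⟨z, hzfix, tendsto_toWeakSpace_of_tendsto_inner fun y => ?_⟩
  refine (tendsto_iff_ultrafilter _ _ _).2 fun V hV => ?_
  obtain ⟨w, hwfix, hw⟩ := hcluster V hV
  obtain ⟨a, ha⟩ := hconv z hzfix
  obtain ⟨b, hb⟩ := hconv w hwfix
  rw [eq_of_tendsto_inner_ultrafilter (Ultrafilter.of_le _) hV (hz _) (hw _) ha hb]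
  exact hw y

end KrasnoselskiiMann

/-! ### Projectors and modified reflectors -/

section Projector

variable {H : Type*} [NormedAddCommGroup H]

theorem isNearestPoint_translate {C : Set H} {q x p : H}
    (h : IsNearestPoint C (q + x) p) : IsNearestPoint (translate C q) x (p - q) := by
  refine ⟨⟨p, h.1, rfl⟩, ?_⟩
  rintro _ ⟨c, hc, rfl⟩
  have e : ∀ a, x - (a - q) = q + x - a := fun a => by abel
  rw [e, e]
  exact h.2 c hc

theorem nonempty_translate {C : Set H} (hC : C.Nonempty) (q : H) : (translate C q).Nonempty :=
  hC.image _

theorem isClosed_translate {C : Set H} (hC : IsClosed C) (q : H) : IsClosed (translate C q) :=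
  (Homeomorph.subRight q).isClosedMap _ hC

variable [InnerProductSpace ℝ H]

theorem isNearestPoint_of_inner_le {C : Set H} (hconv : Convex ℝ C) {x p : H} (hp : p ∈ C)
    (h : ∀ c ∈ C, inner ℝ (x - p) (c - p) ≤ 0) : IsNearestPoint C x p := by
  refine ⟨hp, fun c hc => ?_⟩
  rw [(norm_eq_iInf_iff_real_inner_le_zero hconv hp).2 h]
  exact ciInf_le ⟨0, by rintro _ ⟨c, rfl⟩; exact norm_nonneg _⟩ (⟨c, hc⟩ : C)

theorem convex_translate {C : Set H} (hC : Convex ℝ C) (q : H) : Convex ℝ (translate C q) := by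
  simpa only [translate, sub_eq_neg_add] using hC.translate (-q)

variable [CompleteSpace H]

theorem proj_translate {C : Set H} (hne : C.Nonempty) (hcl : IsClosed C) (hconv : Convex ℝ C)
    (q x : H) : proj (translate C q) x = proj C (q + x) - q :=
  (proj_eq_iff (nonempty_translate hne q) (isClosed_translate hcl q) (convex_translate hconv q)
    _ _).2 (isNearestPoint_translate (isNearestPoint_proj hne hcl hconv _))

/-- If `u ∈ N_C(p)`, then `p - q` is the projection of `p - q + t u` onto `C - q`, for `t ≥ 0`. -/
theorem proj_translate_add_smul {C : Set H} (hne : C.Nonempty) (hcl : IsClosed C)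
    (hconv : Convex ℝ C) {p u : H} (hu : u ∈ normalCone C p) (q : H) {t : ℝ} (ht : 0 ≤ t) :
    proj (translate C q) (p - q + t • u) = p - q := by
  have hp : proj C (q + (p - q + t • u)) = p := by
    refine (proj_eq_iff hne hcl hconv _ _).2 (isNearestPoint_of_inner_le hconv hu.1 fun c hc => ?_)
    have e : q + (p - q + t • u) - p = t • u := by abel
    rw [e, real_inner_smul_left]
    exact mul_nonpos_of_nonneg_of_nonpos ht (hu.2 c hc)
  rw [proj_translate hne hcl hconv, hp]

/-- Projectors are firmly nonexpansive. -/
theorem norm_sq_proj_sub_proj_le {C : Set H} (hne : C.Nonempty) (hcl : IsClosed C)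
    (hconv : Convex ℝ C) (x y : H) :
    ‖proj C x - proj C y‖ ^ 2 ≤ inner ℝ (proj C x - proj C y) (x - y) := by
  have hx := isNearestPoint_proj hne hcl hconv x
  have hy := isNearestPoint_proj hne hcl hconv y
  have h1 := hx.inner_le hconv _ hy.1
  have h2 := hy.inner_le hconv _ hx.1
  have h3 : inner ℝ (proj C x - proj C y) (x - y) - ‖proj C x - proj C y‖ ^ 2 =
      -(inner ℝ (x - proj C x) (proj C y - proj C x) +
        inner ℝ (y - proj C y) (proj C x - proj C y)) := by
    rw [← real_inner_self_eq_norm_sq, ← inner_sub_right, ← neg_sub (proj C x) (proj C y),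
      inner_neg_right, ← sub_eq_neg_add, ← inner_sub_left, real_inner_comm, ← inner_neg_left]
    congr 1
    abel
  linarith

/-- Expanding the square gives a cross term `-4β⟨·,·⟩`; firm nonexpansiveness bounds it, leaving
`4β² - 4β`. -/
theorem norm_sq_modifiedReflector_sub_le {C : Set H} (hne : C.Nonempty) (hcl : IsClosed C)
    (hconv : Convex ℝ C) {β : ℝ} (hβ : 0 ≤ β) (x y : H) :
    ‖modifiedReflector β C x - modifiedReflector β C y‖ ^ 2 ≤
      ‖x - y‖ ^ 2 - 4 * β * (1 - β) * ‖proj C x - proj C y‖ ^ 2 := by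
  have e : modifiedReflector β C x - modifiedReflector β C y =
      (2 * β) • (proj C x - proj C y) - (x - y) := by
    unfold modifiedReflector
    module
  have h := mul_le_mul_of_nonneg_left (norm_sq_proj_sub_proj_le hne hcl hconv x y) hβ
  rw [e, norm_sub_sq_real, norm_smul, mul_pow, Real.norm_eq_abs, sq_abs, real_inner_smul_left]
  linarith

/-! ### The composed operator: contraction estimate, fixed points and shadows -/

variable {A B : Set H} {β : ℝ}

theorem norm_sq_aamrOperator_sub_le (hAne : A.Nonempty) (hAcl : IsClosed A) (hAconv : Convex ℝ A)
    (hBne : B.Nonempty) (hBcl : IsClosed B) (hBconv : Convex ℝ B) (hβ : β ∈ Set.Ioo (0 : ℝ) 1)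
    (q x y : H) :
    ‖aamrOperator β A B q x - aamrOperator β A B q y‖ ^ 2 ≤
      ‖x - y‖ ^ 2 - 4 * β * (1 - β) * ‖proj A (q + x) - proj A (q + y)‖ ^ 2 := by
  have h1 := norm_sq_modifiedReflector_sub_le (nonempty_translate hAne q)
    (isClosed_translate hAcl q) (convex_translate hAconv q) hβ.1.le x y
  have h2 := norm_sq_modifiedReflector_sub_le (nonempty_translate hBne q)
    (isClosed_translate hBcl q) (convex_translate hBconv q) hβ.1.le
    (modifiedReflector β (translate A q) x) (modifiedReflector β (translate A q) y)
  rw [proj_translate hAne hAcl hAconv, proj_translate hAne hAcl hAconv,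
    sub_sub_sub_cancel_right] at h1
  refine (h2.trans (sub_le_self _ (mul_nonneg (mul_nonneg ?_ ?_) (sq_nonneg _)))).trans h1
  · linarith [hβ.1]
  · linarith [hβ.2]

theorem norm_aamrOperator_sub_le (hAne : A.Nonempty) (hAcl : IsClosed A) (hAconv : Convex ℝ A)
    (hBne : B.Nonempty) (hBcl : IsClosed B) (hBconv : Convex ℝ B) (hβ : β ∈ Set.Ioo (0 : ℝ) 1)
    (q x y : H) : ‖aamrOperator β A B q x - aamrOperator β A B q y‖ ≤ ‖x - y‖ := by
  refine (sq_le_sq₀ (norm_nonneg _) (norm_nonneg _)).1 ((norm_sq_aamrOperator_sub_le hAne hAcl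
    hAconv hBne hBcl hBconv hβ q x y).trans (sub_le_self _ (mul_nonneg (mul_nonneg ?_ ?_)
      (sq_nonneg _))))
  · linarith [hβ.1]
  · linarith [hβ.2]

/-- The factor `2(1 - β)` is chosen so that, given `u + v = q - p`, the first reflector exchanges
`u` for `v` and the second exchanges them back. -/
theorem isFixedPt_aamrOperator (hAne : A.Nonempty) (hAcl : IsClosed A) (hAconv : Convex ℝ A)
    (hBne : B.Nonempty) (hBcl : IsClosed B) (hBconv : Convex ℝ B) (hβ : β ≤ 1)
    {q p u v : H} (hu : u ∈ normalCone A p) (hv : v ∈ normalCone B p) (huv : u + v = q - p) :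
    Function.IsFixedPt (aamrOperator β A B q) (p - q + (2 * (1 - β)) • u) := by
  have ht : 0 ≤ 2 * (1 - β) := by linarith
  have hA : modifiedReflector β (translate A q) (p - q + (2 * (1 - β)) • u) =
      p - q + (2 * (1 - β)) • v := by
    rw [modifiedReflector, proj_translate_add_smul hAne hAcl hAconv hu q ht,
      eq_sub_of_add_eq' huv]
    module
  rw [Function.IsFixedPt, aamrOperator, hA, modifiedReflector,
    proj_translate_add_smul hBne hBcl hBconv hv q ht, eq_sub_of_add_eq' huv]
  module

/-- All fixed points have the same shadow, and the shadows of an asymptotically regular bounded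
sequence converge strongly to it. -/
theorem tendsto_proj_of_residual_tendsto_zero (hAne : A.Nonempty) (hAcl : IsClosed A)
    (hAconv : Convex ℝ A) (hBne : B.Nonempty) (hBcl : IsClosed B) (hBconv : Convex ℝ B)
    (hβ : β ∈ Set.Ioo (0 : ℝ) 1) {q z : H} (hz : Function.IsFixedPt (aamrOperator β A B q) z)
    {x : ℕ → H} {R : ℝ} (hR : ∀ n, ‖x n - z‖ ≤ R)
    (hreg : Tendsto (fun n => ‖x n - aamrOperator β A B q (x n)‖) atTop (𝓝 0)) :
    Tendsto (fun n => proj A (q + x n)) atTop (𝓝 (proj A (q + z))) := by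
  have hpos : 0 < 4 * β * (1 - β) := mul_pos (by linarith [hβ.1]) (by linarith [hβ.2])
  -- The gain is at most `‖x n - z‖ ^ 2 - ‖T (x n) - z‖ ^ 2`, with `T` the operator; as a product of
  -- difference and sum, this is at most the residual times `2 * R`.
  have key : ∀ n, ‖proj A (q + x n) - proj A (q + z)‖ ^ 2 ≤
      2 * R / (4 * β * (1 - β)) * ‖x n - aamrOperator β A B q (x n)‖ := by
    intro n
    have h1 := norm_sq_aamrOperator_sub_le hAne hAcl hAconv hBne hBcl hBconv hβ q (x n) z
    rw [hz.eq] at h1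
    have h2 : ‖x n - z‖ ≤ ‖x n - aamrOperator β A B q (x n)‖ + ‖aamrOperator β A B q (x n) - z‖ :=
      norm_sub_le_norm_sub_add_norm_sub _ _ _
    have h3 : ‖aamrOperator β A B q (x n) - z‖ ≤ ‖x n - z‖ := by
      simpa only [hz.eq] using
        norm_aamrOperator_sub_le hAne hAcl hAconv hBne hBcl hBconv hβ q (x n) z
    rw [div_mul_eq_mul_div, le_div_iff₀ hpos]
    nlinarith [hR n, norm_nonneg (x n - aamrOperator β A B q (x n)), norm_nonneg (x n - z),
      norm_nonneg (aamrOperator β A B q (x n) - z)]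
  have hsq : Tendsto (fun n => ‖proj A (q + x n) - proj A (q + z)‖ ^ 2) atTop (𝓝 0) :=
    squeeze_zero (fun n => sq_nonneg _) key (by simpa using hreg.const_mul (2 * R / (4 * β * (1 - β))))
  rw [tendsto_iff_norm_sub_tendsto_zero]
  simpa using hsq.sqrt

theorem proj_eq_of_isFixedPt (hAne : A.Nonempty) (hAcl : IsClosed A)
    (hAconv : Convex ℝ A) (hBne : B.Nonempty) (hBcl : IsClosed B) (hBconv : Convex ℝ B)
    (hβ : β ∈ Set.Ioo (0 : ℝ) 1) {q z w : H}
    (hz : Function.IsFixedPt (aamrOperator β A B q) z)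
    (hw : Function.IsFixedPt (aamrOperator β A B q) w) :
    proj A (q + w) = proj A (q + z) := by
  -- The constant sequence at `w` has zero residual.
  have h := tendsto_proj_of_residual_tendsto_zero hAne hAcl hAconv hBne hBcl hBconv hβ hz
    (x := fun _ => w) (fun _ => le_rfl) (by simp [hw.eq])
  exact tendsto_nhds_unique tendsto_const_nhds h

end Projector

end AAMR

theorem mainTheorem4 {H : Type*} [NormedAddCommGroup H] [InnerProductSpace ℝ H] [CompleteSpace H]
    (A B : Set H)
    (hAne : A.Nonempty) (hAcl : IsClosed A) (hAconv : Convex ℝ A)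
    (hBne : B.Nonempty) (hBcl : IsClosed B) (hBconv : Convex ℝ B)
    (lam : ℕ → ℝ) (hlam : ∀ n, lam n ∈ Set.Icc (0 : ℝ) 1)
    (hlamsum : Tendsto (fun N => ∑ n ∈ Finset.range N, lam n * (1 - lam n)) atTop atTop)
    (β : ℝ) (hβ : β ∈ Set.Ioo (0 : ℝ) 1)
    (q : H) (x : ℕ → H)
    (hx : ∀ n, x (n + 1) = (1 - lam n) • x n + lam n • AAMR.aamrOperator β A B q (x n))
    (hAB : (A ∩ B).Nonempty)
    (hq : q - AAMR.proj (A ∩ B) q ∈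
      AAMR.normalCone A (AAMR.proj (A ∩ B) q) + AAMR.normalCone B (AAMR.proj (A ∩ B) q)) :
    Tendsto (fun n => x (n + 1) - x n) atTop (𝓝 0) ∧
    (∃ xstar : H,
      Function.IsFixedPt (AAMR.aamrOperator β A B q) xstar ∧
      Tendsto (fun n => toWeakSpace ℝ H (x n)) atTop (𝓝 (toWeakSpace ℝ H xstar)) ∧
      AAMR.proj A (q + xstar) = AAMR.proj (A ∩ B) q) ∧
    Tendsto (fun n => AAMR.proj A (q + x n)) atTop (𝓝 (AAMR.proj (A ∩ B) q)) := by

  obtain ⟨u, hu, v, hv, huv⟩ := hq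
  have hT := AAMR.norm_aamrOperator_sub_le hAne hAcl hAconv hBne hBcl hBconv hβ q
  have hz := AAMR.isFixedPt_aamrOperator hAne hAcl hAconv hBne hBcl hBconv hβ.2.le hu hv huv
  have hzproj : AAMR.proj A (q + (AAMR.proj (A ∩ B) q - q + (2 * (1 - β)) • u)) =
      AAMR.proj (A ∩ B) q := by
    have h := AAMR.proj_translate_add_smul hAne hAcl hAconv hu q (t := 2 * (1 - β))
      (by linarith [hβ.2])
    rw [AAMR.proj_translate hAne hAcl hAconv] at h
    exact sub_left_injective h
  have hreg := AAMR.mann_residual_tendsto_zero hT hlam hlamsum hx hz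
  refine ⟨AAMR.mann_sub_succ_tendsto_zero hlam hx hreg, ?_, ?_⟩
  · obtain ⟨xstar, hfix, hweak⟩ := AAMR.mann_tendsto_weak hT hlam hx hreg hz
    exact ⟨xstar, hfix, hweak, (AAMR.proj_eq_of_isFixedPt hAne hAcl hAconv hBne hBcl hBconv hβ
      hz hfix).trans hzproj⟩
  · have h := AAMR.tendsto_proj_of_residual_tendsto_zero hAne hAcl hAconv hBne hBcl hBconv hβ hz
      (AAMR.mann_norm_le hT hlam hx hz) hreg
    rwa [hzproj] at h
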